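/- Theorem. Let $\mathcal G=(I,E)$ be a finite directed acyclic graph and let $c: I\cup E\to\mathcal C$ be a colouring of its vertices and edges; write $c(i)$ for the colour of a vertex $i$ and $c(ij)$ for the colour of an edge $j\to i$, and $\mathrm{ch}(i)=\{k : i\to k\}$ for the set of children of $i$. Assume that $c$ is compatible: no vertex has the same colour as an edge, and if edges $j\to i$ and $l\to k$ satisfy $c(ij)=c(kl)$, then $c(i)=c(k)$. The RDAG model on $(\mathcal G,c)$ is the set of real $I\times I$ matrices $\Psi=(\mathrm{id}-\Lambda)^{\mathsf T}\Omega^{-1}(\mathrm{id}-\Lambda)$, where $\lambda_{ij}=0$ unless $j\to i$ in $\mathcal G$, $\lambda_{ij}=\lambda_{kl}$ whenever the edges $j\to i$ and $l\to k$ have the same colour, and $\Omega$ is a diagonal matrix with positive diagonal entries such that $\omega_{ii}=\omega_{jj}$ whenever $c(i)=c(j)$. Let $(\mathcal G^u,c)$ be the undirected coloured graph obtained by forgetting the directions of the edges and keeping all colours. The RCON model on $(\mathcal G^u,c)$ is the set of real positive definite (symmetric) $I\times I$ matrices $\Psi$ such that $\Psi_{ij}=0$ whenever $i\neq j$ are not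 joined by an edge, $\Psi_{ii}=\Psi_{jj}$ whenever $c(i)=c(j)$, and $\Psi_{ij}=\Psi_{kl}$ whenever $i - j$ and $k - l$ are edges of the same colour. For a vertex $i$, let $\mathcal G_i$ be the coloured directed graph with vertex set $\{i\}\cup\mathrm{ch}(i)$ and edges $i\to k$ for $k\in\mathrm{ch}(i)$, with colours inherited from $(\mathcal G,c)$. For an edge $j\to i$, let $\mathcal G_{(j\to i)}$ be the coloured directed multigraph with vertex set $\{i\}\cup(\mathrm{ch}(i)\cap\mathrm{ch}(j))$, vertex colours inherited from $(\mathcal G,c)$, and, for each $k\in\mathrm{ch}(i)\cap\mathrm{ch}(j)$, two edges $i\to k$, one of colour $c(ki)$ and the other of colour $c(kj)$. Isomorphisms $\simeq$ of coloured directed (multi)graphs are bijections of vertices and of edges that preserve sources, targets and all colours. Then the RDAG model on $(\mathcal G,c)$ is equal to the RCON model on $(\mathcal G^u,c)$ if and only if the following three conditions hold: (a) $\mathcal G$ has no unshielded colliders, i.e. there are no edges $i\to k\leftarrow j$ with $i\neq j$ such that $i$ and $j$ are not joined by an edge; (b) $\mathcal G_i\simeq\mathcal G_j$ for every pair of vertices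 $i,j$ of the same colour; and (c) $\mathcal G_{(j\to i)}\simeq\mathcal G_{(l\to k)}$ for every pair of edges $j\to i$ and $l\to k$ of the same colour. -/

import Mathlib

/-- A coloured directed acyclic graph on the vertex set `V` with colours in `C`:
`G.Adj j i` means that there is an edge `j → i`. Every vertex has a colour and every edge has
a colour, in the same set of colours `C`. -/
structure ColouredDAG (V C : Type*) extends Digraph V where
  /-- there is no directed cycle (in particular no loop) -/
  acyclic : ∀ v, ¬ Relation.TransGen Adj v v
  /-- the colour `c(i)` of a vertex `i` -/
  vertexColour : V → C
  /-- the colour of an edge `j → i`, written `c(ij)` in the usual notation -/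
  edgeColour : ∀ {j i : V}, Adj j i → C

/-- A coloured undirected (simple) graph on the vertex set `V` with colours in `C`. -/
structure ColouredGraph (V C : Type*) extends SimpleGraph V where
  /-- the colour of a vertex -/
  vertexColour : V → C
  /-- the colour of the edge joining `i` and `j` -/
  edgeColour : ∀ {i j : V}, Adj i j → C
  /-- the colour of an edge does not depend on the order of its end points -/
  edgeColour_symm : ∀ {i j : V} (h : Adj i j), edgeColour (symm.symm _ _ h) = edgeColour h

/-- A vertex- and edge-coloured directed multigraph with vertex set `V`, edge set `E`: several
edges may have the same source and the same target. -/
structure ColouredMultidigraph (V E C : Type*) where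
  /-- the source of an edge -/
  source : E → V
  /-- the target of an edge -/
  target : E → V
  /-- the colour of a vertex -/
  vertexColour : V → C
  /-- the colour of an edge -/
  edgeColour : E → C

/-- Two coloured directed multigraphs are isomorphic if there are a bijection between
their vertices and a bijection between their edges that respect sources, targets and colours. -/
def ColouredMultidigraph.Isomorphic {V E V' E' C : Type*}
    (H : ColouredMultidigraph V E C) (H' : ColouredMultidigraph V' E' C) : Prop :=
  ∃ (φ : V ≃ V') (ψ : E ≃ E'),
    (∀ e, H'.source (ψ e) = φ (H.source e)) ∧
    (∀ e, H'.target (ψ e) = φ (H.target e)) ∧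
    (∀ v, H'.vertexColour (φ v) = H.vertexColour v) ∧
    (∀ e, H'.edgeColour (ψ e) = H.edgeColour e)

/-- The RCON (restricted concentration) model on a coloured undirected graph, as a set of
concentration matrices. -/
def ColouredGraph.rconModel {V C : Type*} [Fintype V] (U : ColouredGraph V C) :
    Set (Matrix V V ℝ) :=
  {Ψ | Ψ.PosDef ∧
    (∀ i j, i ≠ j → ¬ U.Adj i j → Ψ i j = 0) ∧
    (∀ i j, U.vertexColour i = U.vertexColour j → Ψ i i = Ψ j j) ∧
    (∀ ⦃i j k l : V⦄ (h : U.Adj i j) (h' : U.Adj k l),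
      U.edgeColour h = U.edgeColour h' → Ψ i j = Ψ k l)}

namespace ColouredDAG

variable {V C : Type*} (G : ColouredDAG V C)

/-- A DAG has no loops. -/
theorem ne_of_adj {j i : V} (h : G.Adj j i) : j ≠ i := by
  rintro rfl
  exact G.acyclic j (Relation.TransGen.single h)

/-- A DAG has no two opposite edges. -/
theorem not_adj_of_adj {j i : V} (h : G.Adj j i) : ¬ G.Adj i j := fun h' =>
  G.acyclic j ((Relation.TransGen.single h).tail h')

open Classical in
/-- The undirected coloured graph that corresponds to a coloured DAG: forget the directions of
the edges; the colour of a directed edge becomes the colour of the undirected edge. -/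
noncomputable def toUndirected : ColouredGraph V C where
  Adj i j := G.Adj i j ∨ G.Adj j i
  symm := ⟨fun _ _ h => h.symm⟩
  loopless := ⟨fun i h => G.ne_of_adj (h.elim id id) rfl⟩
  vertexColour := G.vertexColour
  edgeColour {i j} h := if h' : G.Adj i j then G.edgeColour h'
    else G.edgeColour (h.resolve_left h')
  edgeColour_symm := by
    rintro i j (h | h)
    · have h' := G.not_adj_of_adj h
      simp [h, h']
    · have h' := G.not_adj_of_adj h
      simp [h, h']

/-- A colouring is compatible if (i) vertex colours and edge colours are disjoint, and (ii) edges
`j → i` and `l → k` of the same colour have children `i` and `k` of the same colour. -/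
def Compatible : Prop :=
  (∀ (v : V) ⦃j i : V⦄ (h : G.Adj j i), G.vertexColour v ≠ G.edgeColour h) ∧
  (∀ ⦃j i l k : V⦄ (h : G.Adj j i) (h' : G.Adj l k),
    G.edgeColour h = G.edgeColour h' → G.vertexColour i = G.vertexColour k)

/-- The RDAG (restricted DAG) model on a coloured DAG, as a set of concentration matrices
`(1 - Λ)ᵀ Ω⁻¹ (1 - Λ)`; here `Ω` is the diagonal matrix with diagonal entries `ω i`. -/
def rdagModel [Fintype V] [DecidableEq V] : Set (Matrix V V ℝ) :=
  {Ψ | ∃ (Λ : Matrix V V ℝ) (ω : V → ℝ),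
    (∀ i j, ¬ G.Adj j i → Λ i j = 0) ∧
    (∀ ⦃j i l k : V⦄ (h : G.Adj j i) (h' : G.Adj l k),
      G.edgeColour h = G.edgeColour h' → Λ i j = Λ k l) ∧
    (∀ i, 0 < ω i) ∧
    (∀ i j, G.vertexColour i = G.vertexColour j → ω i = ω j) ∧
    Ψ = (1 - Λ).transpose * (Matrix.diagonal ω)⁻¹ * (1 - Λ)}

/-- There is no unshielded collider, that is, no triple of vertices `i → k ← j` with `i ≠ j`
such that `i` and `j` are not joined by an edge in either direction. -/
def NoUnshieldedColliders : Prop :=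
  ¬ ∃ i j k : V, i ≠ j ∧ G.Adj i k ∧ G.Adj j k ∧ ¬ G.Adj i j ∧ ¬ G.Adj j i

/-- The star of the children of a vertex `i`: the vertices are `i` and its children,
there is one edge `i → k` for every child `k` of `i` (and no other edge), and the colours are
inherited from `G`. The edges are indexed by the children of `i`. -/
def childStar (i : V) :
    ColouredMultidigraph {v : V // v = i ∨ G.Adj i v} {k : V // G.Adj i k} C where
  source _ := ⟨i, Or.inl rfl⟩
  target k := ⟨k.1, Or.inr k.2⟩
  vertexColour v := G.vertexColour v.1
  edgeColour k := G.edgeColour k.2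

/-- The coloured multigraph of an edge `j → i`: the vertices are `i` and the common children of
`i` and `j`, with colours inherited from `G`; every common child `k` of `i` and `j` gives two
edges `i → k`, the first (`Sum.inl k`) with the colour of the edge `i → k` of `G` and the second
(`Sum.inr k`) with the colour of the edge `j → k` of `G`. -/
def edgeGraph {j i : V} (_h : G.Adj j i) :
    ColouredMultidigraph {v : V // v = i ∨ (G.Adj i v ∧ G.Adj j v)}
      ({k : V // G.Adj i k ∧ G.Adj j k} ⊕ {k : V // G.Adj i k ∧ G.Adj j k}) C where
  source _ := ⟨i, Or.inl rfl⟩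
  target := Sum.elim (fun k => ⟨k.1, Or.inr k.2⟩) (fun k => ⟨k.1, Or.inr k.2⟩)
  vertexColour v := G.vertexColour v.1
  edgeColour := Sum.elim (fun k => G.edgeColour k.2.1) (fun k => G.edgeColour k.2.2)

end ColouredDAG

namespace ColouredDAG

variable {V C : Type*} (G : ColouredDAG V C)

/-! With `w = ω⁻¹`, expanding the product gives diagonal entries `w i + ∑ k, w k * Λ k i ^ 2`,
entries `-(w i * Λ i j) + ∑ k, w k * Λ k i * Λ k j` at an edge `j → i`, and the last sum alone at a
non-edge. The sums run over children, respectively common children, so (a), (b), (c) are what makes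
these entries respect the zeros and the colours.

Necessity uses only that RDAG lies in RCON. Put `w = 1` and let the edge weights be arbitrary
functions of the colour: the RCON equations become identities between quadratic forms in the
colours, and such a form determines its multiset of unordered pairs of colours
(`exists_equiv_of_quadratic_eq`).

For sufficiency, RDAG ⊆ RCON follows by reindexing the sums. Conversely, the entries of `Ψ` on the
diagonal and the edges determine `w` and `Λ` recursively from the sinks; positive definiteness
forces `w > 0`, and induction along the same order shows that `w` and `Λ` respect the colours. -/

theorem wellFounded_adj [Finite V] : WellFounded G.Adj := by
  have : IsTrans V (Relation.TransGen G.Adj) := ⟨fun _ _ _ => Relation.TransGen.trans⟩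
  have : Std.Irrefl (Relation.TransGen G.Adj) := ⟨G.acyclic⟩
  exact Subrelation.wf (fun h => Relation.TransGen.single h)
    (Finite.wellFounded_of_trans_of_irrefl (Relation.TransGen G.Adj))

theorem wellFounded_flip_adj [Finite V] : WellFounded (fun k i => G.Adj i k) := by
  have : IsTrans V (Function.swap (Relation.TransGen G.Adj)) :=
    ⟨fun _ _ _ h h' => Relation.TransGen.trans h' h⟩
  have : Std.Irrefl (Function.swap (Relation.TransGen G.Adj)) := ⟨G.acyclic⟩
  exact Subrelation.wf (fun h => Relation.TransGen.single h)
    (Finite.wellFounded_of_trans_of_irrefl (Function.swap (Relation.TransGen G.Adj)))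

theorem not_adj_self (i : V) : ¬ G.Adj i i := fun h => G.ne_of_adj h rfl

/-! ### Isomorphisms of the local coloured graphs as bijections of children -/

/-- A bijection between two subtypes extends to the subtypes with one further point adjoined. -/
theorem exists_equiv_adjoin {p q : V → Prop} {i j : V} (hp : ¬ p i) (hq : ¬ q j)
    (e : {v // p v} ≃ {v // q v}) :
    ∃ φ : {v // v = i ∨ p v} ≃ {v // v = j ∨ q v},
      φ ⟨i, Or.inl rfl⟩ = ⟨j, Or.inl rfl⟩ ∧
      ∀ k : {v // p v}, φ ⟨k.1, Or.inr k.2⟩ = ⟨(e k).1, Or.inr (e k).2⟩ := by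
  classical
  let f : ∀ {p q : V → Prop} {i j : V}, ({v // p v} → {v // q v}) →
      {v // v = i ∨ p v} → {v // v = j ∨ q v} := fun {p q i j} e v =>
    if h : v.1 = i then ⟨j, Or.inl rfl⟩
    else ⟨(e ⟨v.1, v.2.resolve_left h⟩).1, Or.inr (e ⟨v.1, v.2.resolve_left h⟩).2⟩
  have key : ∀ {p q : V → Prop} {i j : V} (_ : ¬ q j) (e : {v // p v} ≃ {v // q v})
      (v : {v // v = i ∨ p v}), f (i := j) (j := i) e.symm (f (j := j) e v) = v := by
    intro p q i j hq e v
    by_cases h : v.1 = i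
    · simp [f, h, Subtype.ext_iff]
    · have : (e ⟨v.1, v.2.resolve_left h⟩).1 ≠ j := fun h' => hq (h' ▸ (e _).2)
      simp [f, h, this]
  refine ⟨⟨f e, f e.symm, key hq e, fun v => by simpa using key hp e.symm v⟩, ?_, ?_⟩
  · simp [f]
  · rintro ⟨k, hk⟩
    have : k ≠ i := fun h => hp (h ▸ hk)
    simp [f, this]

/-- By compatibility an edge colour determines the colour of the head, so a bijection of edges that
keeps colours keeps the vertex colours too. -/
theorem childStar_isomorphic_iff (hc : G.Compatible) {i j : V}
    (hij : G.vertexColour i = G.vertexColour j) :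
    (G.childStar i).Isomorphic (G.childStar j) ↔
      ∃ e : {k // G.Adj i k} ≃ {k // G.Adj j k},
        ∀ k, G.edgeColour (e k).2 = G.edgeColour k.2 := by
  constructor
  · rintro ⟨-, ψ, -, -, -, hψ⟩
    exact ⟨ψ, hψ⟩
  · rintro ⟨e, he⟩
    obtain ⟨φ, hroot, hchild⟩ := exists_equiv_adjoin (G.not_adj_self i) (G.not_adj_self j) e
    refine ⟨φ, e, fun _ => hroot.symm, fun k => (hchild k).symm, ?_, he⟩
    rintro ⟨v, rfl | hv⟩
    · rw [hroot]
      exact hij.symm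
    · rw [hchild ⟨v, hv⟩]
      exact hc.2 _ _ (he ⟨v, hv⟩)

/-- An isomorphism may swap the two parallel edges over a common child, so only the unordered pair
of their colours survives. -/
theorem edgeGraph_isomorphic_iff (hc : G.Compatible) {j i l k : V} (h : G.Adj j i)
    (h' : G.Adj l k) (hik : G.vertexColour i = G.vertexColour k) :
    (G.edgeGraph h).Isomorphic (G.edgeGraph h') ↔
      ∃ e : {m // G.Adj i m ∧ G.Adj j m} ≃ {m // G.Adj k m ∧ G.Adj l m},
        ∀ m, s(G.edgeColour (e m).2.1, G.edgeColour (e m).2.2) =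
          s(G.edgeColour m.2.1, G.edgeColour m.2.2) := by
  classical
  constructor
  · rintro ⟨φ, ψ, -, ht, -, hψ⟩
    have htl : ∀ m, (φ ⟨m.1, Or.inr m.2⟩).1 = (Sum.elim id id (ψ (Sum.inl m))).1 := by
      intro m
      have := congrArg Subtype.val (ht (Sum.inl m))
      rcases hm : ψ (Sum.inl m) with a | a <;> simpa [edgeGraph, hm] using this.symm
    have htr : ∀ m, (φ ⟨m.1, Or.inr m.2⟩).1 = (Sum.elim id id (ψ (Sum.inr m))).1 := by
      intro m
      have := congrArg Subtype.val (ht (Sum.inr m))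
      rcases hm : ψ (Sum.inr m) with a | a <;> simpa [edgeGraph, hm] using this.symm
    have hbij : Function.Bijective
        (fun m : {m // G.Adj i m ∧ G.Adj j m} => Sum.elim id id (ψ (Sum.inl m))) := by
      constructor
      · intro a b hab
        have := (htl a).trans ((congrArg Subtype.val hab).trans (htl b).symm)
        simpa [Subtype.ext_iff] using φ.injective (Subtype.ext this)
      · intro q
        obtain ⟨a, ha⟩ := ψ.surjective (Sum.inl q)
        rcases a with a | a
        · exact ⟨a, by simp [ha]⟩
        · refine ⟨a, Subtype.ext ?_⟩
          rw [← htl, htr, ha]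
          rfl
    refine ⟨Equiv.ofBijective _ hbij, fun m => ?_⟩
    -- Two distinct edges with the same target are the whole pair over that target.
    have key : ∀ x y : {m // G.Adj k m ∧ G.Adj l m} ⊕ {m // G.Adj k m ∧ G.Adj l m}, x ≠ y →
        Sum.elim id id x = Sum.elim id id y →
        s(G.edgeColour (Sum.elim id id x).2.1, G.edgeColour (Sum.elim id id x).2.2) =
          s((G.edgeGraph h').edgeColour x, (G.edgeGraph h').edgeColour y) := by
      rintro (a | a) (b | b) hne (rfl : a = b)
      · exact absurd rfl hne
      · rfl
      · exact Sym2.eq_swap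
      · exact absurd rfl hne
    refine (key (ψ (Sum.inl m)) (ψ (Sum.inr m)) (fun hh => by simpa using ψ.injective hh)
      (Subtype.ext ((htl m).symm.trans (htr m)))).trans ?_
    rw [hψ, hψ]
    rfl
  · rintro ⟨e, he⟩
    obtain ⟨φ, hroot, hchild⟩ := exists_equiv_adjoin
      (fun hi => G.not_adj_self i hi.1) (fun hk => G.not_adj_self k hk.1) e
    -- `P m` says that the colours over `m` match in order; where it fails, `f` swaps the two
    -- parallel edges.
    let P : {m // G.Adj i m ∧ G.Adj j m} → Prop := fun m =>
      G.edgeColour (e m).2.1 = G.edgeColour m.2.1 ∧ G.edgeColour (e m).2.2 = G.edgeColour m.2.2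
    have hP : ∀ m, ¬ P m →
        G.edgeColour (e m).2.1 = G.edgeColour m.2.2 ∧
          G.edgeColour (e m).2.2 = G.edgeColour m.2.1 := fun m hm =>
      (Sym2.eq_iff.1 (he m)).resolve_left hm
    let f : {m // G.Adj i m ∧ G.Adj j m} ⊕ {m // G.Adj i m ∧ G.Adj j m} →
        {m // G.Adj k m ∧ G.Adj l m} ⊕ {m // G.Adj k m ∧ G.Adj l m} :=
      Sum.elim (fun m => if P m then Sum.inl (e m) else Sum.inr (e m))
        (fun m => if P m then Sum.inr (e m) else Sum.inl (e m))
    have hf : Function.Bijective f := by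
      constructor
      · rintro (a | a) (b | b) <;> by_cases ha : P a <;> by_cases hb : P b <;>
          simp only [f, Sum.elim_inl, Sum.elim_inr, if_pos, ha, hb, if_false,
            Sum.inl.injEq, Sum.inr.injEq, EmbeddingLike.apply_eq_iff_eq, reduceCtorEq,
            imp_self, false_imp_iff]
        · rintro rfl; exact absurd ha hb
        · rintro rfl; exact absurd hb ha
        · rintro rfl; exact absurd ha hb
        · rintro rfl; exact absurd hb ha
      · rintro (q | q) <;> obtain ⟨a, rfl⟩ := e.surjective q <;> by_cases ha : P a
        · exact ⟨Sum.inl a, by simp [f, ha]⟩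
        · exact ⟨Sum.inr a, by simp [f, ha]⟩
        · exact ⟨Sum.inr a, by simp [f, ha]⟩
        · exact ⟨Sum.inl a, by simp [f, ha]⟩
    refine ⟨φ, Equiv.ofBijective f hf, fun _ => hroot.symm, ?_, ?_, ?_⟩
    · rintro (m | m) <;> by_cases hm : P m <;> simp [f, hm, edgeGraph, hchild m]
    · rintro ⟨v, rfl | hv⟩
      · rw [hroot]
        exact hik.symm
      · rw [hchild ⟨v, hv⟩]
        rcases Sym2.eq_iff.1 (he ⟨v, hv⟩) with hh | hh
        · exact hc.2 _ _ hh.1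
        · exact hc.2 _ _ hh.1
    · rintro (m | m) <;> by_cases hm : P m
      · simpa [f, hm, edgeGraph] using hm.1
      · simpa [f, hm, edgeGraph] using (hP m hm).2
      · simpa [f, hm, edgeGraph] using hm.2
      · simpa [f, hm, edgeGraph] using (hP m hm).1

end ColouredDAG

namespace ColouredDAG

variable {V C : Type*} (G : ColouredDAG V C)

/-! ### Concentration matrices -/

section Matrices

open Matrix

variable [Fintype V] [DecidableEq V]

/-- `Λ` is supported on the edges of `G`: the entry `Λ i j` is zero unless `j → i`. -/
def Supported (Λ : Matrix V V ℝ) : Prop := ∀ i j, ¬ G.Adj j i → Λ i j = 0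

/-- The concentration matrix `(1 - Λ)ᵀ * diagonal w * (1 - Λ)`. -/
def concentration (Λ : Matrix V V ℝ) (w : V → ℝ) : Matrix V V ℝ :=
  (1 - Λ)ᵀ * diagonal w * (1 - Λ)

theorem concentration_apply (Λ : Matrix V V ℝ) (w : V → ℝ) (i j : V) :
    concentration Λ w i j =
      diagonal w i j - w j * Λ j i - w i * Λ i j + ∑ k, w k * Λ k i * Λ k j := by
  have : concentration Λ w =
      diagonal w - Λᵀ * diagonal w - diagonal w * Λ + Λᵀ * (diagonal w * Λ) := by
    rw [concentration, transpose_sub, transpose_one]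
    noncomm_ring
  rw [this]
  simp only [Matrix.add_apply, Matrix.sub_apply, mul_diagonal, diagonal_mul, transpose_apply]
  rw [Matrix.mul_apply]
  simp only [diagonal_mul, transpose_apply]
  rw [mul_comm (Λ j i)]
  congr 1
  exact Finset.sum_congr rfl fun k _ => by ring

omit [DecidableEq V] in
theorem sum_eq_sum_subtype {p : V → Prop} [DecidablePred p] (f : V → ℝ)
    (h : ∀ k, ¬ p k → f k = 0) : ∑ k, f k = ∑ k : {k // p k}, f k := by
  rw [← Finset.sum_subtype (Finset.univ.filter p) (by simp)]
  exact (Finset.sum_filter_of_ne fun k _ hk => not_not.1 fun hp => hk (h k hp)).symm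

variable {G}

namespace Supported

variable {Λ : Matrix V V ℝ} (hΛ : G.Supported Λ) (w : V → ℝ)
include hΛ

theorem apply_diag (i : V) :
    concentration Λ w i i = w i + ∑ k, w k * Λ k i * Λ k i := by
  rw [concentration_apply, hΛ i i (G.not_adj_self i)]
  simp

theorem apply_adj {i j : V} (h : G.Adj j i) :
    concentration Λ w i j = - (w i * Λ i j) + ∑ k, w k * Λ k i * Λ k j := by
  rw [concentration_apply, hΛ j i (G.not_adj_of_adj h),
    diagonal_apply_ne _ (G.ne_of_adj h).symm]
  simp

theorem apply_not_adj {i j : V} (hij : i ≠ j) (h : ¬ G.Adj i j) (h' : ¬ G.Adj j i) :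
    concentration Λ w i j = ∑ k, w k * Λ k i * Λ k j := by
  rw [concentration_apply, hΛ j i h, hΛ i j h', diagonal_apply_ne _ hij]
  simp

omit [DecidableEq V] in
theorem sum_children [DecidableRel G.Adj] (i : V) :
    ∑ k, w k * Λ k i * Λ k i = ∑ k : {k // G.Adj i k}, w k * Λ k i * Λ k i :=
  sum_eq_sum_subtype _ fun k hk => by rw [hΛ k i hk, mul_zero]

omit [DecidableEq V] in
theorem sum_common_children [DecidableRel G.Adj] (i j : V) :
    ∑ k, w k * Λ k i * Λ k j =
      ∑ k : {k // G.Adj i k ∧ G.Adj j k}, w k * Λ k i * Λ k j := by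
  refine sum_eq_sum_subtype _ fun k hk => ?_
  rcases not_and_or.1 hk with h | h
  · rw [hΛ k i h, mul_zero, zero_mul]
  · rw [hΛ k j h, mul_zero]

/-- `1 - Λ` is unitriangular in a topological order: a kernel vector vanishes at a vertex once it
vanishes at its parents. -/
theorem mulVec_injective : Function.Injective (1 - Λ).mulVec := by
  rw [← Matrix.coe_mulVecLin, ← LinearMap.ker_eq_bot, LinearMap.ker_eq_bot']
  intro x hx
  have hx' : ∀ k, x k = ∑ j, Λ k j * x j := fun k => by
    have := congrFun hx k
    simp only [mulVecLin_apply, sub_mulVec, one_mulVec, Pi.sub_apply, Pi.zero_apply,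
      sub_eq_zero] at this
    exact this
  funext k
  induction k using G.wellFounded_adj.induction with
  | _ k ih =>
    rw [hx']
    refine Finset.sum_eq_zero fun j _ => ?_
    by_cases h : G.Adj j k
    · rw [ih j h, Pi.zero_apply, mul_zero]
    · rw [hΛ k j h, zero_mul]

/-- Column `i` of `(1 - Λ)⁻¹` is supported on the descendants of `i`. It serves as the test vector
that isolates `w i` in the quadratic form. -/
theorem exists_mulVec_eq_single (i : V) :
    ∃ x : V → ℝ, (1 - Λ) *ᵥ x = Pi.single i 1 ∧
      ∀ k, x k ≠ 0 → Relation.ReflTransGen G.Adj i k := by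
  have hsurj : Function.Surjective (1 - Λ).mulVec := by
    have := hΛ.mulVec_injective
    rw [← Matrix.coe_mulVecLin] at this ⊢
    exact LinearMap.surjective_of_injective this
  obtain ⟨x, hx⟩ := hsurj (Pi.single i 1)
  refine ⟨x, hx, fun k => ?_⟩
  have hx' : ∀ k, x k = (Pi.single i 1 : V → ℝ) k + ∑ j, Λ k j * x j := fun k => by
    have := congrFun hx k
    simp only [sub_mulVec, one_mulVec, Pi.sub_apply, sub_eq_iff_eq_add] at this
    exact this
  induction k using G.wellFounded_adj.induction with
  | _ k ih =>
    intro hk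
    by_cases hki : k = i
    · rw [hki]
    rw [hx', Pi.single_eq_of_ne hki, zero_add] at hk
    obtain ⟨j, -, hj⟩ := Finset.exists_ne_zero_of_sum_ne_zero hk
    have hjk : G.Adj j k := not_not.1 fun h => hj (by rw [hΛ k j h, zero_mul])
    exact (ih j hjk (right_ne_zero_of_mul hj)).tail hjk

theorem posDef (hw : ∀ i, 0 < w i) : (concentration Λ w).PosDef := by
  simpa [concentration, conjTranspose_eq_transpose_of_trivial] using
    (PosDef.diagonal hw).conjTranspose_mul_mul_same hΛ.mulVec_injective

end Supported

theorem inv_diagonal_of_pos {ω : V → ℝ} (hω : ∀ i, 0 < ω i) :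
    (diagonal ω)⁻¹ = diagonal fun i => (ω i)⁻¹ := by
  refine Matrix.inv_eq_right_inv ?_
  rw [diagonal_mul_diagonal, ← diagonal_one]
  congr 1
  funext i
  exact mul_inv_cancel₀ (hω i).ne'

/-- The RDAG model, parametrised by `w = ω⁻¹`. -/
theorem mem_rdagModel_iff {Ψ : Matrix V V ℝ} :
    Ψ ∈ G.rdagModel ↔ ∃ (Λ : Matrix V V ℝ) (w : V → ℝ), G.Supported Λ ∧
      (∀ ⦃j i l k : V⦄ (h : G.Adj j i) (h' : G.Adj l k),
        G.edgeColour h = G.edgeColour h' → Λ i j = Λ k l) ∧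
      (∀ i, 0 < w i) ∧ (∀ i j, G.vertexColour i = G.vertexColour j → w i = w j) ∧
      Ψ = concentration Λ w := by
  constructor
  · rintro ⟨Λ, ω, hΛ, hΛc, hω, hωc, rfl⟩
    refine ⟨Λ, fun i => (ω i)⁻¹, hΛ, hΛc, fun i => inv_pos.2 (hω i),
      fun i j h => congrArg (·⁻¹) (hωc i j h), ?_⟩
    rw [inv_diagonal_of_pos hω, concentration]
  · rintro ⟨Λ, w, hΛ, hΛc, hw, hwc, rfl⟩
    refine ⟨Λ, fun i => (w i)⁻¹, hΛ, hΛc, fun i => inv_pos.2 (hw i),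
      fun i j h => congrArg (·⁻¹) (hwc i j h), ?_⟩
    rw [inv_diagonal_of_pos fun i => inv_pos.2 (hw i)]
    simp [concentration]

omit [DecidableEq V] in
-- Positive definite matrices are symmetric, so each edge need only be read in its direction in the
-- DAG.
theorem mem_rconModel_toUndirected_iff {Ψ : Matrix V V ℝ} :
    Ψ ∈ G.toUndirected.rconModel ↔ Ψ.PosDef ∧
      (∀ i j, i ≠ j → ¬ G.Adj i j → ¬ G.Adj j i → Ψ i j = 0) ∧
      (∀ i j, G.vertexColour i = G.vertexColour j → Ψ i i = Ψ j j) ∧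
      (∀ ⦃j i l k : V⦄ (h : G.Adj j i) (h' : G.Adj l k),
        G.edgeColour h = G.edgeColour h' → Ψ i j = Ψ k l) := by
  have hcol : ∀ {j i : V} (h : G.Adj j i),
      G.toUndirected.edgeColour (Or.inl h : G.toUndirected.Adj j i) = G.edgeColour h := by
    intro j i h
    simp [toUndirected, h]
  have hcol' : ∀ {j i : V} (h : G.Adj j i),
      G.toUndirected.edgeColour (Or.inr h : G.toUndirected.Adj i j) = G.edgeColour h := by
    intro j i h
    simp [toUndirected, G.not_adj_of_adj h]
  constructor
  · rintro ⟨hpd, hz, hv, he⟩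
    refine ⟨hpd, fun i j hij h h' => hz i j hij fun hh => hh.elim h h', hv,
      fun j i l k h h' hh => he (Or.inr h) (Or.inr h') ?_⟩
    rw [hcol' h, hcol' h', hh]
  · rintro ⟨hpd, hz, hv, he⟩
    have hsymm : ∀ i j, Ψ i j = Ψ j i := fun i j => by simpa using hpd.1.apply j i
    refine ⟨hpd, fun i j hij h => hz i j hij (fun hh => h (Or.inl hh)) fun hh => h (Or.inr hh),
      hv, ?_⟩
    rintro i j k l (h | h) (h' | h') hh
    · rw [hcol h, hcol h'] at hh
      rw [hsymm i, hsymm k, he h h' hh]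
    · rw [hcol h, hcol' h'] at hh
      rw [hsymm i, he h h' hh]
    · rw [hcol' h, hcol h'] at hh
      rw [hsymm k, he h h' hh]
    · rw [hcol' h, hcol' h'] at hh
      exact he h h' hh

end Matrices

end ColouredDAG

/-! ### Necessity of the local conditions -/

namespace ColouredDAG

variable {V C : Type*} {G : ColouredDAG V C}

/-- Two finite families of unordered pairs that define the same quadratic form agree up to a
bijection of their index types. -/
theorem exists_equiv_of_quadratic_eq {A B : Type*} [Fintype A] [Fintype B] {a b : A → C}
    {a' b' : B → C}
    (h : ∀ x : C → ℝ, ∑ m, x (a m) * x (b m) = ∑ m, x (a' m) * x (b' m)) :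
    ∃ e : A ≃ B, ∀ m, s(a' (e m), b' (e m)) = s(a m, b m) := by
  classical
  -- Polarisation; indicators of two colours `s`, `t` then count the pairs equal to `s(s, t)`, twice
  -- if `s = t`.
  have hpol : ∀ x y : C → ℝ, ∑ m, (x (a m) * y (b m) + y (a m) * x (b m)) =
      ∑ m, (x (a' m) * y (b' m) + y (a' m) * x (b' m)) := by
    intro x y
    have h1 := h (x + y)
    have h2 := h x
    have h3 := h y
    simp only [Pi.add_apply, add_mul, mul_add, Finset.sum_add_distrib] at h1 ⊢
    linarith
  have hind : ∀ s t p q : C,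
      (if p = s then (1 : ℝ) else 0) * (if q = t then 1 else 0) +
        (if p = t then 1 else 0) * (if q = s then 1 else 0) =
      (if s = t then 2 else 1) * (if s(p, q) = s(s, t) then 1 else 0) := by
    intro s t p q
    simp only [Sym2.eq_iff]
    split_ifs <;> grind
  have hcard : ∀ z : Sym2 C,
      Fintype.card {m // s(a m, b m) = z} = Fintype.card {m // s(a' m, b' m) = z} := by
    intro z
    induction z using Sym2.ind with
    | _ s t =>
      have := hpol (fun c => if c = s then 1 else 0) (fun c => if c = t then 1 else 0)
      simp only [hind, ← Finset.mul_sum, Finset.sum_boole] at this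
      rw [Fintype.card_subtype, Fintype.card_subtype]
      exact_mod_cast mul_left_cancel₀ (by split_ifs <;> norm_num) this
  exact ⟨Equiv.ofFiberEquiv fun z => Fintype.equivOfCardEq (hcard z),
    Equiv.ofFiberEquiv_map (f := fun m => s(a m, b m)) (g := fun m => s(a' m, b' m)) _⟩

open Classical in
/-- The matrix of edge weights that takes the value `x c` on the edges of colour `c`. -/
noncomputable def colourMatrix (G : ColouredDAG V C) (x : C → ℝ) : Matrix V V ℝ :=
  Matrix.of fun i j => if h : G.Adj j i then x (G.edgeColour h) else 0

theorem colourMatrix_of_adj (x : C → ℝ) {j i : V} (h : G.Adj j i) :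
    G.colourMatrix x i j = x (G.edgeColour h) := by
  simp [colourMatrix, h]

theorem colourMatrix_of_not_adj (x : C → ℝ) {j i : V} (h : ¬ G.Adj j i) :
    G.colourMatrix x i j = 0 := by
  simp [colourMatrix, h]

theorem supported_colourMatrix (x : C → ℝ) : G.Supported (G.colourMatrix x) :=
  fun _ _ h => colourMatrix_of_not_adj x h

variable [Fintype V] [DecidableEq V]

theorem concentration_colourMatrix_mem (x : C → ℝ) :
    concentration (G.colourMatrix x) 1 ∈ G.rdagModel :=
  mem_rdagModel_iff.2 ⟨_, _, supported_colourMatrix x,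
    fun _ _ _ _ h h' hh => by rw [colourMatrix_of_adj x h, colourMatrix_of_adj x h', hh],
    fun _ => one_pos, fun _ _ _ => rfl, rfl⟩

/-- With all edge weights 1 nothing cancels: a collider at `k` contributes 1 to an entry that must
vanish. -/
theorem noUnshieldedColliders_of_subset (hsub : G.rdagModel ⊆ G.toUndirected.rconModel) :
    G.NoUnshieldedColliders := by
  rintro ⟨i, j, k, hij, hik, hjk, h, h'⟩
  have hz := (mem_rconModel_toUndirected_iff.1
    (hsub (concentration_colourMatrix_mem (G := G) 1))).2.1 i j hij h h'
  rw [(supported_colourMatrix 1).apply_not_adj _ hij h h'] at hz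
  have hnn : ∀ p q, 0 ≤ G.colourMatrix 1 p q := fun p q => by
    by_cases hpq : G.Adj q p
    · simp [colourMatrix_of_adj _ hpq]
    · simp [colourMatrix_of_not_adj _ hpq]
  have := (Finset.sum_eq_zero_iff_of_nonneg fun m _ =>
    mul_nonneg (mul_nonneg zero_le_one (hnn m i)) (hnn m j)).1 hz k (Finset.mem_univ k)
  simp [colourMatrix_of_adj _ hik, colourMatrix_of_adj _ hjk] at this

theorem childStar_isomorphic_of_subset (hc : G.Compatible)
    (hsub : G.rdagModel ⊆ G.toUndirected.rconModel) {i j : V}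
    (hij : G.vertexColour i = G.vertexColour j) :
    (G.childStar i).Isomorphic (G.childStar j) := by
  classical
  rw [childStar_isomorphic_iff G hc hij]
  have key : ∀ (x : C → ℝ) (i : V), concentration (G.colourMatrix x) 1 i i =
      1 + ∑ k : {k // G.Adj i k}, x (G.edgeColour k.2) * x (G.edgeColour k.2) := by
    intro x i
    rw [(supported_colourMatrix x).apply_diag, (supported_colourMatrix x).sum_children]
    simp only [Pi.one_apply, one_mul]
    congr 1
    exact Finset.sum_congr rfl fun k _ => by rw [colourMatrix_of_adj x k.2]
  obtain ⟨e, he⟩ := exists_equiv_of_quadratic_eq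
    (a := fun k : {k // G.Adj i k} => G.edgeColour k.2) (b := fun k => G.edgeColour k.2)
    (a' := fun k : {k // G.Adj j k} => G.edgeColour k.2) (b' := fun k => G.edgeColour k.2)
    fun x => by
      have := (mem_rconModel_toUndirected_iff.1
        (hsub (concentration_colourMatrix_mem (G := G) x))).2.2.1 i j hij
      rw [key, key] at this
      exact add_left_cancel this
  exact ⟨e, fun k => by simpa using he k⟩

/-- The linear terms of the two entries agree because the edges share a colour, which leaves an
identity of quadratic forms. -/
theorem edgeGraph_isomorphic_of_subset (hc : G.Compatible)
    (hsub : G.rdagModel ⊆ G.toUndirected.rconModel) {j i l k : V} (h : G.Adj j i)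
    (h' : G.Adj l k) (hh : G.edgeColour h = G.edgeColour h') :
    (G.edgeGraph h).Isomorphic (G.edgeGraph h') := by
  classical
  rw [edgeGraph_isomorphic_iff G hc h h' (hc.2 h h' hh)]
  have key : ∀ (x : C → ℝ) {j i : V} (h : G.Adj j i),
      concentration (G.colourMatrix x) 1 i j = - x (G.edgeColour h) +
        ∑ k : {k // G.Adj i k ∧ G.Adj j k}, x (G.edgeColour k.2.1) * x (G.edgeColour k.2.2) := by
    intro x j i h
    rw [(supported_colourMatrix x).apply_adj _ h,
      (supported_colourMatrix x).sum_common_children, colourMatrix_of_adj x h]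
    simp only [Pi.one_apply, one_mul]
    congr 1
    exact Finset.sum_congr rfl fun k _ => by
      rw [colourMatrix_of_adj x k.2.1, colourMatrix_of_adj x k.2.2]
  refine exists_equiv_of_quadratic_eq
    (a := fun m : {m // G.Adj i m ∧ G.Adj j m} => G.edgeColour m.2.1)
    (b := fun m => G.edgeColour m.2.2)
    (a' := fun m : {m // G.Adj k m ∧ G.Adj l m} => G.edgeColour m.2.1)
    (b' := fun m => G.edgeColour m.2.2) fun x => ?_
  have := (mem_rconModel_toUndirected_iff.1
    (hsub (concentration_colourMatrix_mem (G := G) x))).2.2.2 h h' hh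
  rw [key x h, key x h', hh] at this
  exact add_left_cancel this

/-! ### From the local conditions to the equality of models -/

section LocalSums

variable {Λ : Matrix V V ℝ} {w : V → ℝ}

omit [DecidableEq V] in
theorem Supported.sum_children_eq (hΛ : G.Supported Λ) {i j : V}
    (e : {k // G.Adj i k} ≃ {k // G.Adj j k})
    (hw : ∀ k : {k // G.Adj i k}, w k = w (e k))
    (he : ∀ k : {k // G.Adj i k}, Λ k i = Λ (e k) j) :
    ∑ k, w k * Λ k i * Λ k i = ∑ k, w k * Λ k j * Λ k j := by
  classical
  rw [hΛ.sum_children, hΛ.sum_children]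
  exact Fintype.sum_equiv e _ _ fun k => by rw [hw, he]

omit [DecidableEq V] in
-- Only products of weights are compared, since the bijection may exchange the two colours.
theorem Supported.sum_common_children_eq (hΛ : G.Supported Λ) {j i l k : V}
    (e : {m // G.Adj i m ∧ G.Adj j m} ≃ {m // G.Adj k m ∧ G.Adj l m})
    (hw : ∀ m : {m // G.Adj i m ∧ G.Adj j m}, w m = w (e m))
    (he : ∀ m : {m // G.Adj i m ∧ G.Adj j m}, Λ m i * Λ m j = Λ (e m) k * Λ (e m) l) :
    ∑ m, w m * Λ m i * Λ m j = ∑ m, w m * Λ m k * Λ m l := by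
  classical
  rw [hΛ.sum_common_children, hΛ.sum_common_children]
  exact Fintype.sum_equiv e _ _ fun m => by rw [mul_assoc, mul_assoc, hw, he]

omit [DecidableEq V] in
theorem Supported.sum_eq_zero_of_noUnshieldedColliders (hΛ : G.Supported Λ)
    (ha : G.NoUnshieldedColliders) {i j : V} (hij : i ≠ j) (h : ¬ G.Adj i j)
    (h' : ¬ G.Adj j i) : ∑ k, w k * Λ k i * Λ k j = 0 := by
  refine Finset.sum_eq_zero fun k _ => ?_
  by_cases hi : G.Adj i k
  · by_cases hj : G.Adj j k
    · exact absurd ⟨i, j, k, hij, hi, hj, h, h'⟩ ha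
    · rw [hΛ k j hj, mul_zero]
  · rw [hΛ k i hi, mul_zero, zero_mul]

end LocalSums

/-- The conditions on the stars of children and on the edge graphs, in terms of bijections of
children. -/
structure LocallyHomogeneous (G : ColouredDAG V C) : Prop where
  children : ∀ {i j : V}, G.vertexColour i = G.vertexColour j →
    ∃ e : {k // G.Adj i k} ≃ {k // G.Adj j k}, ∀ k, G.edgeColour (e k).2 = G.edgeColour k.2
  commonChildren : ∀ {j i l k : V} (h : G.Adj j i) (h' : G.Adj l k),
    G.edgeColour h = G.edgeColour h' →
    ∃ e : {m // G.Adj i m ∧ G.Adj j m} ≃ {m // G.Adj k m ∧ G.Adj l m},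
      ∀ m, s(G.edgeColour (e m).2.1, G.edgeColour (e m).2.2) =
        s(G.edgeColour m.2.1, G.edgeColour m.2.2)

theorem rdagModel_subset (hc : G.Compatible) (ha : G.NoUnshieldedColliders)
    (hG : G.LocallyHomogeneous) : G.rdagModel ⊆ G.toUndirected.rconModel := by
  intro Ψ hΨ
  obtain ⟨Λ, w, hΛ, hΛc, hw, hwc, rfl⟩ := mem_rdagModel_iff.1 hΨ
  refine mem_rconModel_toUndirected_iff.2 ⟨hΛ.posDef w hw, ?_, ?_, ?_⟩
  · intro i j hij h h'
    rw [hΛ.apply_not_adj w hij h h', hΛ.sum_eq_zero_of_noUnshieldedColliders ha hij h h']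
  · intro i j hij
    obtain ⟨e, he⟩ := hG.children hij
    rw [hΛ.apply_diag, hΛ.apply_diag, hwc i j hij, hΛ.sum_children_eq e
      (fun k => hwc _ _ (hc.2 _ _ (he k).symm)) fun k => hΛc _ _ (he k).symm]
  · intro j i l k h h' hh
    obtain ⟨e, he⟩ := hG.commonChildren h h' hh
    rw [hΛ.apply_adj w h, hΛ.apply_adj w h', hwc i k (hc.2 h h' hh), hΛc h h' hh,
      hΛ.sum_common_children_eq e (fun m => ?_) fun m => ?_]
    · rcases Sym2.eq_iff.1 (he m) with hm | hm
      · exact hwc _ _ (hc.2 _ _ hm.1.symm)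
      · exact hwc _ _ (hc.2 _ _ hm.1.symm)
    · rcases Sym2.eq_iff.1 (he m) with hm | hm
      · rw [hΛc _ _ hm.1, hΛc _ _ hm.2]
      · rw [hΛc _ _ hm.1, hΛc _ _ hm.2, mul_comm]

omit [DecidableEq V] in
/-- The recursion, from the sinks upwards, that determines `Λ` and `w` from the entries of
`Ψ = (1 - Λ)ᵀ * diagonal w * (1 - Λ)` on the diagonal and on the edges. -/
theorem exists_cholesky_recursion (G : ColouredDAG V C) (Ψ : Matrix V V ℝ) :
    ∃ (Λ : Matrix V V ℝ) (w : V → ℝ), G.Supported Λ ∧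
      (∀ i, w i = Ψ i i - ∑ k, w k * Λ k i * Λ k i) ∧
      ∀ ⦃j i : V⦄, G.Adj j i → Λ i j = (w i)⁻¹ * (∑ k, w k * Λ k i * Λ k j - Ψ i j) := by
  classical
  -- The value at `i` is `w i` paired with row `i` of `Λ`. Nothing yet excludes `w i = 0`, in which
  -- case the inverse is 0.
  let step : ∀ i, (∀ k, G.Adj i k → ℝ × (V → ℝ)) → ℝ × (V → ℝ) := fun i rec =>
    let w := Ψ i i - ∑ k, if h : G.Adj i k then (rec k h).1 * (rec k h).2 i * (rec k h).2 i else 0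
    (w, fun j => if G.Adj j i then w⁻¹ *
      (∑ k, (if h : G.Adj i k then (rec k h).1 * (rec k h).2 i * (rec k h).2 j else 0) - Ψ i j)
      else 0)
  let F := G.wellFounded_flip_adj.fix step
  have hF : ∀ i, F i = step i fun k _ => F k := fun i => G.wellFounded_flip_adj.fix_eq step i
  have hsupp : ∀ i j, ¬ G.Adj j i → (F i).2 j = 0 := fun i j h => by
    rw [hF]
    simp [step, h]
  have hsum : ∀ i j, (∑ k, if G.Adj i k then (F k).1 * (F k).2 i * (F k).2 j else 0) =
      ∑ k, (F k).1 * (F k).2 i * (F k).2 j := fun i j =>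
    Finset.sum_congr rfl fun k _ => by
      split_ifs with h
      · rfl
      · rw [hsupp k i h, mul_zero, zero_mul]
  have hw : ∀ i, (F i).1 = Ψ i i - ∑ k, (F k).1 * (F k).2 i * (F k).2 i := fun i => by
    rw [← hsum, hF i]
    simp [step]
  refine ⟨Matrix.of fun i => (F i).2, fun i => (F i).1, hsupp, hw, fun j i h => ?_⟩
  simp only [Matrix.of_apply]
  rw [hw, ← hsum, ← hsum i j, hF i]
  simp [step, h]

theorem rconModel_subset (hc : G.Compatible) (ha : G.NoUnshieldedColliders)
    (hG : G.LocallyHomogeneous) : G.toUndirected.rconModel ⊆ G.rdagModel := by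
  intro Ψ hΨ
  obtain ⟨hpd, hz, hv, he⟩ := mem_rconModel_toUndirected_iff.1 hΨ
  obtain ⟨Λ, w, hΛ, hw, hΛw⟩ := G.exists_cholesky_recursion Ψ
  have hΨsymm : ∀ i j, Ψ i j = Ψ j i := fun i j => by simpa using hpd.1.apply j i
  have hcsymm : ∀ i j, concentration Λ w i j = concentration Λ w j i := fun i j => by
    have : (concentration Λ w).transpose = concentration Λ w := by
      simp [concentration, Matrix.mul_assoc]
    rw [← this, Matrix.transpose_apply, this]
  have hadj : ∀ {j i : V}, G.Adj j i → w i ≠ 0 → Ψ i j = concentration Λ w i j := by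
    intro j i h hi
    rw [hΛ.apply_adj w h, hΛw h, mul_inv_cancel_left₀ hi]
    ring
  -- An entry is recovered as soon as `w` is nonzero at the head of the edge, if there is one; this
  -- local form is what the proof of positivity can use.
  have hentry : ∀ i j, (G.Adj j i → w i ≠ 0) → (G.Adj i j → w j ≠ 0) →
      Ψ i j = concentration Λ w i j := by
    intro i j h h'
    rcases eq_or_ne i j with rfl | hij
    · rw [hΛ.apply_diag, hw i]
      ring
    by_cases hji : G.Adj j i
    · exact hadj hji (h hji)
    by_cases hij' : G.Adj i j
    · rw [hΨsymm, hcsymm]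
      exact hadj hij' (h' hij')
    · rw [hz i j hij hij' hji, hΛ.apply_not_adj w hij hij' hji,
        hΛ.sum_eq_zero_of_noUnshieldedColliders ha hij hij' hji]
  have hpos : ∀ i, 0 < w i := by
    have hacyc : ∀ {i a b : V}, Relation.ReflTransGen G.Adj i a → G.Adj a b →
        Relation.TransGen G.Adj i b := fun h h' => Relation.TransGen.tail' h h'
    -- Positivity is carried along for all descendants of `i`, because the test vector is supported
    -- there.
    suffices ∀ i b, Relation.ReflTransGen G.Adj i b → 0 < w b from fun i => this i i .refl
    intro i
    induction i using G.wellFounded_flip_adj.induction with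
    | _ i ih =>
      have ih' : ∀ b, Relation.TransGen G.Adj i b → 0 < w b := fun b hb => by
        obtain ⟨k, hik, hkb⟩ := Relation.TransGen.head'_iff.1 hb
        exact ih k hik b hkb
      intro b hb
      rcases Relation.reflTransGen_iff_eq_or_transGen.1 hb with rfl | hb
      swap
      · exact ih' b hb
      obtain ⟨x, hx, hxs⟩ := hΛ.exists_mulVec_eq_single b
      have hx0 : x ≠ 0 := by
        rintro rfl
        simpa using congrFun hx b
      -- The head of an edge within the support of `x` is a proper descendant of `b`, where `w` is
      -- already positive.
      have hval : x ⬝ᵥ Matrix.mulVec Ψ x = x ⬝ᵥ Matrix.mulVec (concentration Λ w) x := by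
        simp only [dotProduct, Matrix.mulVec, Finset.mul_sum]
        refine Finset.sum_congr rfl fun p _ => Finset.sum_congr rfl fun q _ => ?_
        by_cases hp : x p = 0
        · simp [hp]
        by_cases hq : x q = 0
        · simp [hq]
        rw [hentry p q (fun h => (ih' p (hacyc (hxs q hq) h)).ne')
          fun h => (ih' q (hacyc (hxs p hp) h)).ne']
      have hconc : x ⬝ᵥ Matrix.mulVec (concentration Λ w) x = w b := by
        rw [concentration, ← Matrix.mulVec_mulVec, ← Matrix.mulVec_mulVec, hx,
          Matrix.dotProduct_mulVec, Matrix.vecMul_transpose, hx]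
        simp
      have := hpd.dotProduct_mulVec_pos hx0
      rwa [star_trivial, hval, hconc] at this
  -- The induction is on `i` alone and the vertex or edge compared with it is arbitrary, so the
  -- hypothesis at a child of `i` applies to its image under the bijection.
  have hcol : ∀ i : V, (∀ j, G.vertexColour i = G.vertexColour j → w i = w j) ∧
      ∀ ⦃a l k : V⦄ (h : G.Adj a i) (h' : G.Adj l k), G.edgeColour h = G.edgeColour h' →
        Λ i a = Λ k l := by
    intro i
    induction i using G.wellFounded_flip_adj.induction with
    | _ i ih =>
      have hwi : ∀ j, G.vertexColour i = G.vertexColour j → w i = w j := by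
        intro j hij
        obtain ⟨e, hcol⟩ := hG.children hij
        rw [hw i, hw j, hv i j hij, hΛ.sum_children_eq e
          (fun k => (ih k k.2).1 _ (hc.2 _ _ (hcol k).symm))
          fun k => (ih k k.2).2 _ _ (hcol k).symm]
      refine ⟨hwi, fun a l k h h' hh => ?_⟩
      obtain ⟨e, hcol⟩ := hG.commonChildren h h' hh
      rw [hΛw h, hΛw h', hwi k (hc.2 h h' hh), he h h' hh,
        hΛ.sum_common_children_eq e (fun m => ?_) fun m => ?_]
      · rcases Sym2.eq_iff.1 (hcol m) with hm | hm
        · exact (ih m m.2.1).1 _ (hc.2 _ _ hm.1.symm)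
        · exact (ih m m.2.1).1 _ (hc.2 _ _ hm.1.symm)
      · rcases Sym2.eq_iff.1 (hcol m) with hm | hm
        · rw [(ih m m.2.1).2 _ _ hm.1.symm, (ih m m.2.1).2 _ _ hm.2.symm]
        · rw [(ih m m.2.1).2 _ _ hm.1.symm, (ih m m.2.1).2 _ _ hm.2.symm, mul_comm]
  refine mem_rdagModel_iff.2 ⟨Λ, w, hΛ, fun j i l k h h' hh => (hcol i).2 h h' hh, hpos,
    fun i j hij => (hcol i).1 j hij, ?_⟩
  ext i j
  exact hentry i j (fun _ => (hpos i).ne') fun _ => (hpos j).ne'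

end ColouredDAG

theorem theorem3p3 {V C : Type*} [Fintype V] [DecidableEq V] (G : ColouredDAG V C)
    (hc : G.Compatible) :
    G.rdagModel = G.toUndirected.rconModel ↔
      G.NoUnshieldedColliders ∧
      (∀ i j : V, G.vertexColour i = G.vertexColour j →
        (G.childStar i).Isomorphic (G.childStar j)) ∧
      (∀ ⦃j i l k : V⦄ (h : G.Adj j i) (h' : G.Adj l k), G.edgeColour h = G.edgeColour h' →
        (G.edgeGraph h).Isomorphic (G.edgeGraph h')) := by
  constructor
  · intro heq
    exact ⟨ColouredDAG.noUnshieldedColliders_of_subset heq.subset,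
      fun i j => ColouredDAG.childStar_isomorphic_of_subset hc heq.subset,
      fun j i l k => ColouredDAG.edgeGraph_isomorphic_of_subset hc heq.subset⟩
  · rintro ⟨ha, hb, hd⟩
    have hG : G.LocallyHomogeneous :=
      ⟨fun {i j} hij => (G.childStar_isomorphic_iff hc hij).1 (hb i j hij),
        fun h h' hh => (G.edgeGraph_isomorphic_iff hc h h' (hc.2 h h' hh)).1 (hd h h' hh)⟩
    exact (ColouredDAG.rdagModel_subset hc ha hG).antisymm
      (ColouredDAG.rconModel_subset hc ha hG)
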